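/- Let $A_1,A_2,A_3,\mathrm{d}O\in\mathbb R^{n\times d}$ and $X,Y\in\mathbb R^{d\times d}$. Put $A=\exp(A_1XA_2^\top)$ (entrywise), $f=\mathrm{diag}(A\mathbf 1_n)^{-1}A$, $q=\mathrm{d}O\,(A_3Y)^\top$, let $p\in\mathbb R^{n\times n}$ have rows $p_j=(\mathrm{diag}(f_j)-f_jf_j^\top)q_j$ (with $f_j,q_j$ the rows of $f,q$), and let the attention gradient be $g=A_1^\top pA_2\in\mathbb R^{d\times d}$. An algorithm that computes the attention gradient with standard matrix multiplication is a finite directed acyclic graph whose input nodes (no parents) are the entries of $A_1,A_2,A_3,\mathrm{d}O,X,Y$, in which every other node applies a real function to the values of its parents, whose output nodes (no children) are the $d^2$ entries of $g$, computed correctly for all real inputs, and in which $A_1XA_2^\top$ is formed either as $(A_1X)A_2^\top$ or as $A_1(XA_2^\top)$ by two standard matrix multiplications: for a product $BC$ with inner dimension $d$ there is a product node for every $B_{i,k}C_{k,j}$, and $(BC)_{i,j}$ is the root of a binary summation tree of any shape over $k=1,\dots,d$. The rest of the computation is arbitrary. The I/O complexity $Q(G,M)$ of such a graph $G$ with cache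 size $M\ge 1$ is the least number of input and output operations in a complete play of the red-blue pebble game with at most $M$ red pebbles present at any time ($Q(G,M)=\infty$ if there is no complete play). Initially exactly the input nodes carry blue pebbles and there are no red ones. The moves are: input (put a red pebble on a node with a blue pebble), output (put a blue pebble on a node with a red pebble), compute (put a red pebble on a non-input node all of whose parents have red pebbles), delete (remove a pebble). A play is complete when all output nodes carry blue pebbles. Theorem. If the cache size is $M=o(d^2)$, then any algorithm that computes the attention gradient with standard matrix multiplication has I/O complexity $$\Omega\!\left(\frac{n^2d+nd^2}{\sqrt M}\right).$$ That is, there is an absolute constant $c>0$ such that along every family of parameters $(n,d,M)$ with $M\ge1$ and $M=o(d^2)$, eventually every such algorithm $G$ satisfies $Q(G,M)\ge c\,\dfrac{n^2d+nd^2}{\sqrt M}$. -/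

import Mathlib

open scoped ENNReal Matrix
open Filter Asymptotics

/-! ## Computational graphs and the red-blue pebble game -/

/-- A finite directed acyclic graph, given by the set of parents of each node. -/
structure CompGraph where
  V : Type
  [fintypeV : Fintype V]
  [decEqV : DecidableEq V]
  parents : V → Finset V
  acyclic : WellFounded (fun u v => u ∈ parents v)

attribute [instance] CompGraph.fintypeV CompGraph.decEqV

namespace CompGraph

/-- Input nodes are the nodes without parents. -/
def IsInput (G : CompGraph) (v : G.V) : Prop := G.parents v = ∅

/-- Output nodes are the nodes without children. -/
def IsOutput (G : CompGraph) (v : G.V) : Prop := ∀ w, v ∉ G.parents w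

/-- A position of the game: the nodes carrying a red pebble (cache) and the nodes carrying a blue
pebble (memory). A node may carry both. -/
structure Position (G : CompGraph) where
  red : Finset G.V
  blue : Finset G.V

open Classical in
/-- Initially exactly the input nodes carry blue pebbles, and there is no red pebble. -/
noncomputable def start (G : CompGraph) : G.Position where
  red := ∅
  blue := Finset.univ.filter (fun v => G.IsInput v)

/-- One move, together with its number of input/output operations. An input (output) operation
puts a red (blue) pebble on a node carrying a blue (red) one, which stays there until it is
deleted. Deletions are free, so replacing the pebble is this move followed by a deletion, at the
same cost. Only a node that has parents can be computed: an input can enter the cache only by an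
input operation. -/
inductive Step (G : CompGraph) : G.Position → ℕ → G.Position → Prop
  | input (c : G.Position) (v : G.V) (h : v ∈ c.blue) :
      Step G c 1 { c with red := insert v c.red }
  | output (c : G.Position) (v : G.V) (h : v ∈ c.red) :
      Step G c 1 { c with blue := insert v c.blue }
  | compute (c : G.Position) (v : G.V) (hv : ¬ G.IsInput v) (h : G.parents v ⊆ c.red) :
      Step G c 0 { c with red := insert v c.red }
  | deleteRed (c : G.Position) (v : G.V) :
      Step G c 0 { c with red := c.red.erase v }
  | deleteBlue (c : G.Position) (v : G.V) :
      Step G c 0 { c with blue := c.blue.erase v }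

/-- `G.Play M c q c'`: some sequence of moves leads from `c` to `c'`, with at most `M` red pebbles
in every position on the way, and uses `q` input and output operations in total. -/
inductive Play (G : CompGraph) (M : ℕ) : G.Position → ℕ → G.Position → Prop
  | nil (c : G.Position) (h : c.red.card ≤ M) : Play G M c 0 c
  | cons {c c' c'' : G.Position} {k q : ℕ} (h : c.red.card ≤ M) (hs : G.Step c k c')
      (hp : Play G M c' q c'') : Play G M c (k + q) c''

/-- The game can be completed with cache size `M` and `q` input and output operations: at the end
all output nodes carry blue pebbles. -/
def CompletesWith (G : CompGraph) (M q : ℕ) : Prop :=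
  ∃ c : G.Position, G.Play M G.start q c ∧ ∀ v, G.IsOutput v → v ∈ c.blue

/-- The I/O complexity `Q(G, M)`: the least number of input and output operations of a complete
play with at most `M` red pebbles (`⊤` if the cache is too small for any complete play). -/
noncomputable def ioComplexity (G : CompGraph) (M : ℕ) : ℕ∞ :=
  ⨅ (q : ℕ) (_ : G.CompletesWith M q), (q : ℕ∞)

end CompGraph

/-! ## Algorithms: computational graphs with operations -/

/-- An algorithm with input variables `ι`: its input nodes are the variables, and every other node
applies some real function to the values of its parents (`op` is not used at input nodes). -/
structure Algorithm (ι : Type) extends CompGraph where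
  inputs : {v : V // parents v = ∅} ≃ ι
  op : (v : V) → ({u : V // u ∈ parents v} → ℝ) → ℝ

namespace Algorithm

variable {ι : Type}

/-- The node of an input variable. -/
def inputNode (P : Algorithm ι) (a : ι) : P.V := (P.inputs.symm a).1

/-- The value of each node when the input variables have the values `x`. -/
noncomputable def eval (P : Algorithm ι) (x : ι → ℝ) : P.V → ℝ :=
  P.acyclic.fix (fun v ih =>
    if h : P.parents v = ∅ then x (P.inputs ⟨v, h⟩) else P.op v (fun u => ih u.1 u.2))

/-- `v` is a product node: it multiplies the values of its two parents `u` and `w`. -/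
def IsMulNode (P : Algorithm ι) (u w v : P.V) : Prop :=
  P.parents v = {u, w} ∧ ∀ a : P.V → ℝ, P.op v (fun y => a y.1) = a u * a w

/-- `v` is a sum node: it adds the values of its two parents `u` and `w`. -/
def IsAddNode (P : Algorithm ι) (u w v : P.V) : Prop :=
  P.parents v = {u, w} ∧ ∀ a : P.V → ℝ, P.op v (fun y => a y.1) = a u + a w

/-- `P.IsSumTree leaf s v`: the node `v` is the root of a (binary) summation tree, of any shape,
whose leaves are the nodes `leaf k` with `k ∈ s`, each occurring once. -/
inductive IsSumTree (P : Algorithm ι) {r : ℕ} (leaf : Fin r → P.V) :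
    Finset (Fin r) → P.V → Prop
  | leaf (k : Fin r) : IsSumTree P leaf {k} (leaf k)
  | add {s t : Finset (Fin r)} {u w v : P.V} (hs : IsSumTree P leaf s u)
      (ht : IsSumTree P leaf t w) (hst : Disjoint s t) (hv : P.IsAddNode u w v) :
      IsSumTree P leaf (s ∪ t) v

/-- The nodes `C` are computed from the nodes `A` and `B` by standard matrix multiplication: there
are product nodes for all `A i k * B k j`, and `C i j` is the root of a summation tree over `k`. -/
def IsStdMatMul (P : Algorithm ι) {m r p : ℕ} (A : Matrix (Fin m) (Fin r) P.V)
    (B : Matrix (Fin r) (Fin p) P.V) (C : Matrix (Fin m) (Fin p) P.V) : Prop :=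
  ∃ prod : Fin m → Fin r → Fin p → P.V,
    (∀ i k j, P.IsMulNode (A i k) (B k j) (prod i k j)) ∧
    ∀ i j, P.IsSumTree (fun k => prod i k j) Finset.univ (C i j)

/-- The nodes `E` are computed from `A`, `B`, `C` by two standard matrix multiplications, as
`(A B) C` or as `A (B C)`. -/
def IsStdTripleProduct (P : Algorithm ι) {m r p s : ℕ} (A : Matrix (Fin m) (Fin r) P.V)
    (B : Matrix (Fin r) (Fin p) P.V) (C : Matrix (Fin p) (Fin s) P.V)
    (E : Matrix (Fin m) (Fin s) P.V) : Prop :=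
  (∃ S : Matrix (Fin m) (Fin p) P.V, P.IsStdMatMul A B S ∧ P.IsStdMatMul S C E) ∨
  (∃ S : Matrix (Fin r) (Fin s) P.V, P.IsStdMatMul B C S ∧ P.IsStdMatMul A S E)

end Algorithm

/-! ## The attention gradient -/

/-- The inputs of the backward pass: `A₁`, `A₂`, `A₃`, the upstream gradient `dO`, and the weights
`X`, `Y`. -/
structure AttentionData (n d : ℕ) where
  A₁ : Matrix (Fin n) (Fin d) ℝ
  A₂ : Matrix (Fin n) (Fin d) ℝ
  A₃ : Matrix (Fin n) (Fin d) ℝ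
  dO : Matrix (Fin n) (Fin d) ℝ
  X : Matrix (Fin d) (Fin d) ℝ
  Y : Matrix (Fin d) (Fin d) ℝ

namespace AttentionData

variable {n d : ℕ}

/-- `A(X) = exp(A₁ X A₂ᵀ)`, entrywise. -/
noncomputable def expScore (D : AttentionData n d) : Matrix (Fin n) (Fin n) ℝ :=
  (D.A₁ * D.X * D.A₂ᵀ).map Real.exp

/-- The normalizing vector `l(X) = A(X) 1`. -/
noncomputable def l (D : AttentionData n d) : Fin n → ℝ := D.expScore *ᵥ 1

/-- The attention matrix `f(X) = diag(l(X))⁻¹ A(X)` (softmax of each row of `A₁ X A₂ᵀ`). -/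
noncomputable def f (D : AttentionData n d) : Matrix (Fin n) (Fin n) ℝ :=
  Matrix.of fun i j => (D.l i)⁻¹ * D.expScore i j

/-- `h(Y) = A₃ Y`. -/
noncomputable def h (D : AttentionData n d) : Matrix (Fin n) (Fin d) ℝ := D.A₃ * D.Y

/-- `q(Y) = dO h(Y)ᵀ`. -/
noncomputable def q (D : AttentionData n d) : Matrix (Fin n) (Fin n) ℝ := D.dO * D.hᵀ

/-- The matrix `p(X)`, with rows `(diag(fᵢ) - fᵢ fᵢᵀ) qᵢ`. -/
noncomputable def p (D : AttentionData n d) : Matrix (Fin n) (Fin n) ℝ :=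
  Matrix.of fun i =>
    (Matrix.diagonal (D.f i) - Matrix.vecMulVec (D.f i) (D.f i)) *ᵥ (D.q i)

/-- The attention gradient `dL/dX = A₁ᵀ p(X) A₂`. -/
noncomputable def gradient (D : AttentionData n d) : Matrix (Fin d) (Fin d) ℝ :=
  D.A₁ᵀ * D.p * D.A₂

end AttentionData

/-- The scalar input variables: the entries of `A₁`, `A₂`, `A₃`, `dO`, `X`, `Y`. -/
inductive AttentionVar (n d : ℕ) : Type
  | A₁ (i : Fin n) (k : Fin d)
  | A₂ (i : Fin n) (k : Fin d)
  | A₃ (i : Fin n) (k : Fin d)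
  | dO (i : Fin n) (k : Fin d)
  | X (k l : Fin d)
  | Y (k l : Fin d)

/-- The value of each scalar input variable. -/
def AttentionData.entry {n d : ℕ} (D : AttentionData n d) : AttentionVar n d → ℝ
  | .A₁ i k => D.A₁ i k
  | .A₂ i k => D.A₂ i k
  | .A₃ i k => D.A₃ i k
  | .dO i k => D.dO i k
  | .X k l => D.X k l
  | .Y k l => D.Y k l

/-- An algorithm that computes the attention gradient with standard matrix multiplication. Its
input nodes are the entries of `A₁, A₂, A₃, dO, X, Y` and its output nodes are the entries of the
gradient, which it computes correctly for all real inputs; the product `A₁ X A₂ᵀ` is formed by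
standard matrix multiplication, in either order. No condition is put on the remaining
computation, so that every choice of its order, its summation trees and its elementary
operations is covered. -/
structure AttentionGradientAlgorithm (n d : ℕ) extends Algorithm (AttentionVar n d) where
  outputs : {v : V // toAlgorithm.IsOutput v} ≃ Fin d × Fin d
  correct : ∀ (D : AttentionData n d) (a b : Fin d),
    toAlgorithm.eval D.entry (outputs.symm (a, b)).1 = D.gradient a b
  standard : ∃ score : Matrix (Fin n) (Fin n) V,
    toAlgorithm.IsStdTripleProduct
      (Matrix.of fun i k => toAlgorithm.inputNode (.A₁ i k))
      (Matrix.of fun k l => toAlgorithm.inputNode (.X k l))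
      (Matrix.of fun l j => toAlgorithm.inputNode (.A₂ j l))
      score

/-! The cost is already forced by the two standard multiplications that form `A₁ X A₂ᵀ`. This is a
segment argument that allows recomputation. A complete play with `q` transfers is cut into `q / M +
1` segments of at most `M` transfers each. In a segment at most `2M` nodes are in the cache
initially or get loaded (`Trace.dom`), and at most `2M` are in the cache at the end or get newly
written to memory (`Trace.out`).

Each product `A i k * B k j` reaches `C i j` along a path in a summation tree, and paths of
different entries of `C` are disjoint. A path with no pebbles can only be entered by computing its
product, with both factors in the cache. Loomis–Whitney therefore bounds the products used in a
segment by the entries of `A` and `B` seen, together with the entries of `C` that are seen or have a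
path meeting `out` (`card_becomeLive_sq_le`).

For input matrices at most `2M` entries are seen. The intermediate matrix is not an input: a visible
entry either has a path meeting `dom`, or has all its `d` products computed within the segment.
Loomis–Whitney and `M ≤ d ^ 2` leave at most `4M` entries of the second kind, hence `6M` in all
(`card_root_le_mul`). So a segment accounts for `O(M ^ (3/2))` products of either multiplication,
out of `n d ^ 2` and `n ^ 2 d`. Finally all of `X` must be loaded, so `q ≥ d ^ 2 ≥ M`, which absorbs
the extra segment. -/

/-! ### Loomis–Whitney inequality. -/

open Finset in
/-- The discrete Loomis–Whitney inequality in dimension three. -/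
theorem card_sq_le_of_projections {α β γ : Type*} [DecidableEq α] [DecidableEq β] [DecidableEq γ]
    (T : Finset (α × β × γ)) (X : Finset (α × β)) (Y : Finset (β × γ)) (Z : Finset (α × γ))
    (hX : ∀ x ∈ T, (x.1, x.2.1) ∈ X) (hY : ∀ x ∈ T, (x.2.1, x.2.2) ∈ Y)
    (hZ : ∀ x ∈ T, (x.1, x.2.2) ∈ Z) : #T ^ 2 ≤ #X * #Y * #Z := by
  have h1 : #T = ∑ z ∈ Z, #{x ∈ T | (x.1, x.2.2) = z} :=
    card_eq_sum_card_fiberwise (f := fun x : α × β × γ => (x.1, x.2.2)) (s := T) (t := Z) fun x hx => hZ x hx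
  have h2 : ∑ z ∈ Z, #{x ∈ T | (x.1, x.2.2) = z} ^ 2 ≤ #X * #Y := by
    have h3 : ∀ z ∈ Z, #{x ∈ T | (x.1, x.2.2) = z} ^ 2
        = #({x ∈ T | (x.1, x.2.2) = z} ×ˢ {x ∈ T | (x.1, x.2.2) = z}) := fun z _ => by
      rw [card_product, sq]
    rw [sum_congr rfl h3, ← card_sigma, ← card_product]
    -- Two points `x`, `y` of one fibre share their first and third coordinates, so the
    -- `X`-projection of `x` and the `Y`-projection of `y` determine the pair and the fibre.
    refine card_le_card_of_injOn
      (fun w => ((w.2.1.1, w.2.1.2.1), (w.2.2.2.1, w.2.2.2.2))) ?_ ?_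
    · rintro ⟨z, x, y⟩ h
      simp only [coe_sigma, Set.mem_sigma_iff, mem_coe, mem_product, mem_filter] at h
      simp only [coe_product, Set.mem_prod, mem_coe]
      exact ⟨hX _ h.2.1.1, hY _ h.2.2.1⟩
    · rintro ⟨⟨z1, z2⟩, ⟨x1, x2, x3⟩, ⟨y1, y2, y3⟩⟩ h ⟨⟨z1', z2'⟩, ⟨x1', x2', x3'⟩, ⟨y1', y2', y3'⟩⟩ h' e
      simp only [coe_sigma, Set.mem_sigma_iff, mem_coe, mem_product, mem_filter,
        Prod.mk.injEq] at h h' e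
      obtain ⟨-, ⟨-, rfl, rfl⟩, -, rfl, rfl⟩ := h
      obtain ⟨-, ⟨-, rfl, rfl⟩, -, h5, h6⟩ := h'
      obtain ⟨⟨rfl, rfl⟩, rfl, rfl⟩ := e
      subst h5; subst h6; rfl
  calc #T ^ 2 = (∑ z ∈ Z, #{x ∈ T | (x.1, x.2.2) = z}) ^ 2 := by rw [← h1]
    _ ≤ #Z * ∑ z ∈ Z, #{x ∈ T | (x.1, x.2.2) = z} ^ 2 := sq_sum_le_card_mul_sum_sq
    _ ≤ #Z * (#X * #Y) := Nat.mul_le_mul_left _ h2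
    _ = #X * #Y * #Z := by ring

/-! ### Plays indexed by time, and how nodes enter the cache. -/

namespace CompGraph

/-- A play of length `L` in which the positions are indexed by time. -/
structure Trace (G : CompGraph) (M L : ℕ) where
  pos : ℕ → G.Position
  cost : ℕ → ℕ
  step : ∀ t < L, G.Step (pos t) (cost t) (pos (t + 1))
  card_red : ∀ t ≤ L, (pos t).red.card ≤ M

theorem Play.exists_trace {G : CompGraph} {M q : ℕ} {c c' : G.Position} (h : G.Play M c q c') :
    ∃ (L : ℕ) (τ : G.Trace M L), τ.pos 0 = c ∧ τ.pos L = c' ∧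
      ∑ t ∈ Finset.range L, τ.cost t = q := by
  induction h with
  | nil c h => exact ⟨0, ⟨fun _ => c, fun _ => 0, by simp, fun _ _ => h⟩, rfl, rfl, by simp⟩
  | @cons c c' c'' k q h hs _ ih =>
    obtain ⟨L, τ, h0, hL, hq⟩ := ih
    refine ⟨L + 1, ⟨fun t => Nat.casesOn t c τ.pos, fun t => Nat.casesOn t k τ.cost, ?_, ?_⟩,
      rfl, hL, ?_⟩
    · rintro (_ | t) ht
      · simpa [h0] using hs
      · exact τ.step t (by omega)
    · rintro (_ | t) ht
      · exact h
      · exact τ.card_red t (by omega)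
    · rw [Finset.sum_range_succ', ← hq, add_comm]; rfl

/-- A set of nodes that can only be entered at `p`: every other node of it has a parent in it. -/
def EnteredAt (G : CompGraph) (p : G.V) (S : Set G.V) : Prop :=
  ∀ v ∈ S, v = p ∨ ∃ u ∈ G.parents v, u ∈ S

namespace Step

variable {G : CompGraph} {c c' : G.Position} {k : ℕ}

theorem cost_le_one (h : G.Step c k c') : k ≤ 1 := by cases h <;> simp

theorem card_blue_sdiff_le (h : G.Step c k c') : (c'.blue \ c.blue).card ≤ k := by
  cases h with
  | output v h =>
    refine (Finset.card_le_card (t := {v}) fun x hx => ?_).trans (by simp)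
    simp only [Finset.mem_sdiff, Finset.mem_insert] at hx
    simpa [hx.2] using hx.1
  | deleteBlue v => simp [Finset.sdiff_eq_empty_iff_subset.2 (Finset.erase_subset _ _)]
  | _ => simp

theorem card_red_sdiff_le (h : G.Step c 1 c') : (c'.red \ c.red).card ≤ 1 := by
  cases h with
  | input v h =>
    refine (Finset.card_le_card (t := {v}) fun x hx => ?_).trans (by simp)
    simp only [Finset.mem_sdiff, Finset.mem_insert] at hx
    simpa [hx.2] using hx.1
  | output v h => simp

theorem mem_red_of_mem_blue (h : G.Step c k c') {v : G.V} (hv : v ∈ c'.blue)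
    (hv' : v ∉ c.blue) : v ∈ c.red := by
  cases h with
  | output w h =>
    rcases Finset.mem_insert.1 hv with rfl | h1
    · exact h
    · exact absurd h1 hv'
  | deleteBlue w => exact absurd (Finset.mem_of_mem_erase hv) hv'
  | _ => exact absurd hv hv'

theorem mem_blue_or_computed (h : G.Step c k c') {v : G.V} (hv : v ∈ c'.red)
    (hv' : v ∉ c.red) :
    (k = 1 ∧ v ∈ c.blue) ∨ (¬ G.IsInput v ∧ G.parents v ⊆ c.red) := by
  cases h with
  | input w h =>
    rcases Finset.mem_insert.1 hv with rfl | h1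
    · exact .inl ⟨rfl, h⟩
    · exact absurd h1 hv'
  | compute w hw h =>
    rcases Finset.mem_insert.1 hv with rfl | h1
    · exact .inr ⟨hw, h⟩
    · exact absurd h1 hv'
  | deleteRed w => exact absurd (Finset.mem_of_mem_erase hv) hv'
  | _ => exact absurd hv hv'

end Step

namespace Trace

variable {G : CompGraph} {M L : ℕ} (τ : G.Trace M L)

/-- The nodes that enter the cache by an input operation at time `t`. -/
def loaded (t : ℕ) : Finset G.V :=
  if τ.cost t = 1 then (τ.pos (t + 1)).red \ (τ.pos t).red else ∅

/-- The nodes in the cache at time `a`, or loaded between the times `a` and `b`. -/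
def dom (a b : ℕ) : Finset G.V := (τ.pos a).red ∪ (Finset.Ico a b).biUnion τ.loaded

/-- The nodes in the cache at time `b`, or written to memory between the times `a` and `b`. -/
def out (a b : ℕ) : Finset G.V :=
  (τ.pos b).red ∪ (Finset.Ico a b).biUnion fun t => (τ.pos (t + 1)).blue \ (τ.pos t).blue

open Classical in
/-- The nodes in the cache at some time between `a` and `b`. -/
noncomputable def everRed (a b : ℕ) : Finset G.V := (Finset.Icc a b).biUnion fun t => (τ.pos t).red

theorem mem_everRed {a b : ℕ} {v : G.V} :
    v ∈ τ.everRed a b ↔ ∃ t, a ≤ t ∧ t ≤ b ∧ v ∈ (τ.pos t).red := by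
  simp [everRed, and_assoc]

theorem card_dom_le {a b : ℕ} (hb : b ≤ L) :
    (τ.dom a b).card ≤ (τ.pos a).red.card + ∑ t ∈ Finset.Ico a b, τ.cost t := by
  refine (Finset.card_union_le _ _).trans (Nat.add_le_add_left ?_ _)
  refine Finset.card_biUnion_le.trans (Finset.sum_le_sum fun t ht => ?_)
  have hs := τ.step t ((Finset.mem_Ico.1 ht).2.trans_le hb)
  unfold loaded
  split_ifs with h
  · rw [h] at hs ⊢; exact hs.card_red_sdiff_le
  · simp

theorem card_out_le {a b : ℕ} (hb : b ≤ L) :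
    (τ.out a b).card ≤ (τ.pos b).red.card + ∑ t ∈ Finset.Ico a b, τ.cost t := by
  refine (Finset.card_union_le _ _).trans (Nat.add_le_add_left ?_ _)
  exact Finset.card_biUnion_le.trans (Finset.sum_le_sum fun t ht =>
    (τ.step t ((Finset.mem_Ico.1 ht).2.trans_le hb)).card_blue_sdiff_le)

theorem mem_dom_or_computed {a b t : ℕ} (hb : b ≤ L) (hat : a ≤ t) (htb : t < b) {v : G.V}
    (hv : v ∈ (τ.pos (t + 1)).red) (hv' : v ∉ (τ.pos t).red) :
    (v ∈ τ.dom a b ∧ v ∈ (τ.pos t).blue) ∨ (¬ G.IsInput v ∧ G.parents v ⊆ (τ.pos t).red) := by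
  refine ((τ.step t (htb.trans_le hb)).mem_blue_or_computed hv hv').imp_left fun h => ⟨?_, h.2⟩
  refine Finset.mem_union_right _ (Finset.mem_biUnion.2 ⟨t, Finset.mem_Ico.2 ⟨hat, htb⟩, ?_⟩)
  simp [loaded, h.1, hv, hv']

/-- If a property fails at time `a` and holds at time `b`, it changes at some step. -/
theorem exists_change {Q : ℕ → Prop} {a b : ℕ} (hab : a ≤ b) (ha : ¬ Q a) (hb : Q b) :
    ∃ t, a ≤ t ∧ t < b ∧ ¬ Q t ∧ Q (t + 1) := by
  induction b, hab using Nat.le_induction with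
  | base => exact absurd hb ha
  | succ b hab ih =>
    by_cases h : Q b
    · obtain ⟨t, h1, h2, h3⟩ := ih h
      exact ⟨t, h1, by omega, h3⟩
    · exact ⟨b, hab, by omega, h, hb⟩

/-- An input cannot be computed, so it is in the cache from the start of the segment or is loaded.
-/
theorem mem_dom_of_isInput {a b : ℕ} (hb : b ≤ L) {v : G.V} (hi : G.IsInput v)
    (hv : v ∈ τ.everRed a b) : v ∈ τ.dom a b := by
  obtain ⟨t, hat, htb, ht⟩ := τ.mem_everRed.1 hv
  by_cases ha : v ∈ (τ.pos a).red
  · exact Finset.mem_union_left _ ha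
  · obtain ⟨s, h1, h2, h3, h4⟩ := exists_change (Q := fun t => v ∈ (τ.pos t).red) hat ha ht
    rcases τ.mem_dom_or_computed hb h1 (h2.trans_le htb) h4 h3 with h | h
    · exact h.1
    · exact absurd hi h.1

/-- When the cache first meets `S`, the entering node was not loaded, so it was computed. Unless it
is `p`, it has a parent in `S` that was already in the cache, a contradiction. -/
theorem parents_subset_everRed_of_disjoint_dom {a b : ℕ} (hb : b ≤ L) {p : G.V} {S : Set G.V}
    (hS : EnteredAt G p S) (hdom : ∀ v ∈ S, v ∉ τ.dom a b) {v : G.V} (hvS : v ∈ S)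
    (hv : v ∈ τ.everRed a b) : G.parents p ⊆ τ.everRed a b := by
  obtain ⟨t, hat, htb, ht⟩ := τ.mem_everRed.1 hv
  obtain ⟨s, h1, h2, h3, w, hw, h4⟩ :=
    exists_change (Q := fun t => ∃ v ∈ S, v ∈ (τ.pos t).red) hat
      (fun ⟨w, hw, h⟩ => hdom w hw (Finset.mem_union_left _ h)) ⟨v, hvS, ht⟩
  rcases τ.mem_dom_or_computed hb h1 (h2.trans_le htb) h4 (fun h => h3 ⟨w, hw, h⟩) with h | h
  · exact absurd h.1 (hdom w hw)
  rcases hS w hw with rfl | ⟨u, hu, huS⟩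
  · exact fun x hx => τ.mem_everRed.2 ⟨s, h1, by omega, h.2 hx⟩
  · exact absurd ⟨u, huS, h.2 hu⟩ h3

/-- The same argument with pebbles of either colour: loading needs an earlier blue pebble in `S`,
and writing an earlier red one. -/
theorem parents_subset_everRed_of_no_pebble {a b t : ℕ} (hb : b ≤ L) {p : G.V} {S : Set G.V}
    (hS : EnteredAt G p S) (ha : ∀ v ∈ S, v ∉ (τ.pos a).red ∧ v ∉ (τ.pos a).blue)
    (hat : a ≤ t) (htb : t ≤ b) {v : G.V} (hvS : v ∈ S)
    (hv : v ∈ (τ.pos t).red ∨ v ∈ (τ.pos t).blue) : G.parents p ⊆ τ.everRed a b := by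
  obtain ⟨s, h1, h2, h3, w, hw, h4⟩ :=
    exists_change (Q := fun t => ∃ v ∈ S, v ∈ (τ.pos t).red ∨ v ∈ (τ.pos t).blue) hat
      (fun ⟨w, hw, h⟩ => h.elim (ha w hw).1 (ha w hw).2) ⟨v, hvS, hv⟩
  rcases h4 with h4 | h4
  · rcases τ.mem_dom_or_computed hb h1 (h2.trans_le htb) h4 (fun h => h3 ⟨w, hw, .inl h⟩)
      with h | h
    · exact absurd ⟨w, hw, .inr h.2⟩ h3
    rcases hS w hw with rfl | ⟨u, hu, huS⟩
    · exact fun x hx => τ.mem_everRed.2 ⟨s, h1, by omega, h.2 hx⟩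
    · exact absurd ⟨u, huS, .inl (h.2 hu)⟩ h3
  · exact absurd ⟨w, hw, .inl ((τ.step s (by omega)).mem_red_of_mem_blue h4
      (fun h => h3 ⟨w, hw, .inr h⟩))⟩ h3

theorem mem_out_of_pebble {a b : ℕ} (hab : a ≤ b) {v : G.V} (ha : v ∉ (τ.pos a).blue)
    (hv : v ∈ (τ.pos b).red ∨ v ∈ (τ.pos b).blue) : v ∈ τ.out a b := by
  rcases hv with hv | hv
  · exact Finset.mem_union_left _ hv
  · obtain ⟨s, h1, h2, h3, h4⟩ := exists_change (Q := fun t => v ∈ (τ.pos t).blue) hab ha hv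
    exact Finset.mem_union_right _ (Finset.mem_biUnion.2
      ⟨s, Finset.mem_Ico.2 ⟨h1, h2⟩, Finset.mem_sdiff.2 ⟨h4, h3⟩⟩)

theorem computed_of_pebble (h0 : τ.pos 0 = G.start) {v : G.V} (hv : ¬ G.IsInput v) {t : ℕ}
    (ht : t ≤ L) (hvt : v ∈ (τ.pos t).red ∨ v ∈ (τ.pos t).blue) :
    v ∈ τ.everRed 0 L ∧ G.parents v ⊆ τ.everRed 0 L := by
  refine ⟨?_, τ.parents_subset_everRed_of_no_pebble le_rfl (S := {v}) (fun w hw => .inl hw)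
    (by rintro w rfl; simp [h0, start, hv]) (Nat.zero_le t) ht rfl hvt⟩
  rcases hvt with h | h
  · exact τ.mem_everRed.2 ⟨t, Nat.zero_le t, ht, h⟩
  · obtain ⟨s, -, h2, h3, h4⟩ := exists_change (Q := fun t => v ∈ (τ.pos t).blue)
      (Nat.zero_le t) (by simp [h0, start, hv]) h
    exact τ.mem_everRed.2 ⟨s, Nat.zero_le s, by omega,
      (τ.step s (by omega)).mem_red_of_mem_blue h4 h3⟩

theorem wellFounded_children (G : CompGraph) :
    WellFounded fun w u : G.V => u ∈ G.parents w := by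
  have h1 : IsStrictOrder G.V (Relation.TransGen fun w u => u ∈ G.parents w) :=
    { irrefl := fun a h => by
        have h2 := Relation.transGen_swap.1 h
        exact G.acyclic.transGen.irrefl.irrefl a h2
      trans := fun a b c => Relation.TransGen.trans }
  exact Subrelation.wf (fun h => Relation.TransGen.single h)
    (Finite.wellFounded_of_trans_of_irrefl (Relation.TransGen fun w u => u ∈ G.parents w))

/-- In a complete play every node that is not an input is computed. -/
theorem computed_of_complete (h0 : τ.pos 0 = G.start)
    (hL : ∀ v, G.IsOutput v → v ∈ (τ.pos L).blue) (v : G.V) (hv : ¬ G.IsInput v) :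
    v ∈ τ.everRed 0 L ∧ G.parents v ⊆ τ.everRed 0 L := by
  induction v using (wellFounded_children G).induction with
  | _ v ih =>
  -- The induction runs backwards from the outputs: any other node has a child, and computing that
  -- child puts the node in the cache.
  by_cases ho : G.IsOutput v
  · exact τ.computed_of_pebble h0 hv le_rfl (.inr (hL v ho))
  · simp only [IsOutput, not_forall, not_not] at ho
    obtain ⟨w, hw⟩ := ho
    have hwi : ¬ G.IsInput w := fun h => by rw [IsInput] at h; simp [h] at hw
    obtain ⟨t, -, ht, h⟩ := τ.mem_everRed.1 ((ih w hw hwi).2 hw)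
    exact τ.computed_of_pebble h0 hv ht (.inl h)

end Trace

/-! ### Counting the entries and products handled in one segment. -/

/-- Summation trees of a standard matrix multiplication `C = A B` in a computational graph: the
node set `path i k j` leads from the product node of `A i k` and `B k j` to the root `C i j`, and
the paths of different entries of `C` are disjoint. -/
structure ProductPaths (G : CompGraph) {m r p : ℕ} (A : Fin m → Fin r → G.V)
    (B : Fin r → Fin p → G.V) (C : Fin m → Fin p → G.V) where
  prod : Fin m → Fin r → Fin p → G.V
  path : Fin m → Fin r → Fin p → Set G.V
  parents_prod : ∀ i k j, G.parents (prod i k j) = {A i k, B k j}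
  enteredAt : ∀ i k j, EnteredAt G (prod i k j) (path i k j)
  root_mem : ∀ i k j, C i j ∈ path i k j
  disjoint : ∀ {i k j i' k' j' v}, v ∈ path i k j → v ∈ path i' k' j' → i = i' ∧ j = j'
  not_isInput : ∀ {i k j v}, v ∈ path i k j → ¬ G.IsInput v

open Classical in
/-- The indices of the entries of `A` that lie in the set `R`. -/
noncomputable def entriesIn {G : CompGraph} {m r : ℕ} (A : Fin m → Fin r → G.V) (R : Finset G.V) :
    Finset (Fin m × Fin r) := {x | A x.1 x.2 ∈ R}

theorem card_entriesIn_le {G : CompGraph} {m r : ℕ} {A : Fin m → Fin r → G.V}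
    (hA : ∀ i k i' k', A i k = A i' k' → i = i' ∧ k = k') {R D : Finset G.V}
    (hRD : ∀ i k, A i k ∈ R → A i k ∈ D) : (entriesIn A R).card ≤ D.card := by
  refine Finset.card_le_card_of_injOn (fun x => A x.1 x.2) ?_ ?_
  · rintro x hx
    exact hRD _ _ (by simpa [entriesIn] using hx)
  · rintro ⟨i, k⟩ - ⟨i', k'⟩ - h
    exact Prod.ext (hA _ _ _ _ h).1 (hA _ _ _ _ h).2

namespace ProductPaths

variable {G : CompGraph} {m r p : ℕ} {A : Fin m → Fin r → G.V} {B : Fin r → Fin p → G.V}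
  {C : Fin m → Fin p → G.V} (F : G.ProductPaths A B C) {M L : ℕ} (τ : G.Trace M L)

open Classical in
/-- The entries of `C` whose paths meet the set `D`. -/
noncomputable def touched (D : Finset G.V) : Finset (Fin m × Fin p) :=
  {x | ∃ k, ∃ v ∈ F.path x.1 k x.2, v ∈ D}

/-- By disjointness a node lies on the paths of at most one entry of `C`. -/
theorem card_touched_le (D : Finset G.V) : (F.touched D).card ≤ D.card := by
  classical
  refine Finset.card_le_card_of_forall_subsingleton
    (fun x v => ∃ k, v ∈ F.path x.1 k x.2) ?_ ?_
  · intro x hx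
    obtain ⟨k, v, hv, hD⟩ := (Finset.mem_filter.1 hx).2
    exact ⟨v, hD, k, hv⟩
  · rintro v - x ⟨-, k, hk⟩ y ⟨-, k', hk'⟩
    exact Prod.ext (F.disjoint hk hk').1 (F.disjoint hk hk').2

/-- The number of entries of `C` that are in the cache at some time between `a` and `b`. -/
theorem card_root_everRed_le (F : G.ProductPaths A B C) {a b : ℕ} (hb : b ≤ L) :
    ∃ N : ℕ, N * r ^ 2 ≤ (entriesIn A (τ.everRed a b)).card * (entriesIn B (τ.everRed a b)).card ∧
      (entriesIn C (τ.everRed a b)).card ≤ (τ.dom a b).card + N := by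
  classical
  set R := τ.everRed a b with hR
  set Z := entriesIn C R \ F.touched (τ.dom a b) with hZ
  refine ⟨Z.card, ?_, ?_⟩
  -- For an entry of `Z` no path meets `dom`, so all `r` of its products are computed in the
  -- segment.
  · have hpar : ∀ x ∈ Z, ∀ k, A x.1 k ∈ R ∧ B k x.2 ∈ R := by
      intro x hx k
      simp only [hZ, Finset.mem_sdiff, entriesIn, touched, Finset.mem_filter, Finset.mem_univ,
        true_and, not_exists, not_and] at hx
      have h := τ.parents_subset_everRed_of_disjoint_dom hb (F.enteredAt x.1 k x.2) (hx.2 k)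
        (F.root_mem _ k _) hx.1
      rw [F.parents_prod] at h
      exact ⟨h (by simp), h (by simp)⟩
    have h := card_sq_le_of_projections
      (({x | (x.1, x.2.2) ∈ Z} : Finset (Fin m × Fin r × Fin p))) (entriesIn A R)
      (entriesIn B R) Z
      (fun x hx => Finset.mem_filter.2
        ⟨Finset.mem_univ _, (hpar _ (Finset.mem_filter.1 hx).2 x.2.1).1⟩)
      (fun x hx => Finset.mem_filter.2
        ⟨Finset.mem_univ _, (hpar _ (Finset.mem_filter.1 hx).2 x.2.1).2⟩)
      (fun x hx => (Finset.mem_filter.1 hx).2)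
    have hcard : Z.card * r ≤
        (({x | (x.1, x.2.2) ∈ Z} : Finset (Fin m × Fin r × Fin p))).card := by
      calc Z.card * r = (Z ×ˢ (Finset.univ : Finset (Fin r))).card := by simp
        _ ≤ _ := Finset.card_le_card_of_injOn (fun y => (y.1.1, y.2, y.1.2))
          (fun y hy => by simpa using hy)
          (by rintro ⟨⟨x, y⟩, z⟩ - ⟨⟨x', y'⟩, z'⟩ - h; simp_all)
    -- Loomis–Whitney gives `(#Z * r) ^ 2 ≤ #A * #B * #Z`, with `#A` and `#B` the numbers of entries
    -- seen; one factor `#Z` cancels.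
    rcases Nat.eq_zero_or_pos Z.card with h0 | h0
    · simp [h0]
    · refine Nat.le_of_mul_le_mul_left ?_ h0
      calc Z.card * (Z.card * r ^ 2) = (Z.card * r) ^ 2 := by ring
        _ ≤ _ := (Nat.pow_le_pow_left hcard 2).trans h
        _ = _ := by ring
  · calc (entriesIn C R).card ≤ (F.touched (τ.dom a b) ∪ Z).card :=
        Finset.card_le_card (by rw [hZ, Finset.union_sdiff_self_eq_union]; exact Finset.subset_union_right)
      _ ≤ _ := (Finset.card_union_le _ _).trans (Nat.add_le_add_right (F.card_touched_le _) _)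

/-- The product of `A i k` and `B k j` has been used by time `t`: a node on its path carries a
pebble, or `C i j` has been in the cache. -/
def Live (t : ℕ) (x : Fin m × Fin r × Fin p) : Prop :=
  (∃ v ∈ F.path x.1 x.2.1 x.2.2, v ∈ (τ.pos t).red ∨ v ∈ (τ.pos t).blue) ∨
    C x.1 x.2.2 ∈ τ.everRed 0 t

open Classical in
/-- The products that become live between the times `a` and `b`. -/
noncomputable def becomeLive (a b : ℕ) : Finset (Fin m × Fin r × Fin p) :=
  {x | ¬ F.Live τ a x ∧ F.Live τ b x}

/-- A newly live product has both factors seen in the segment. A pebble on its path at time `b` lies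
on a node of `out`, since that node was not blue at time `a`; otherwise the root itself was seen. -/
theorem card_becomeLive_sq_le {a b : ℕ} (hab : a ≤ b) (hb : b ≤ L) :
    (F.becomeLive τ a b).card ^ 2 ≤
      (entriesIn A (τ.everRed a b)).card * (entriesIn B (τ.everRed a b)).card *
        ((τ.out a b).card + (entriesIn C (τ.everRed a b)).card) := by
  classical
  set R := τ.everRed a b with hR
  have hmem : ∀ x ∈ F.becomeLive τ a b,
      (A x.1 x.2.1 ∈ R ∧ B x.2.1 x.2.2 ∈ R) ∧
        ((x.1, x.2.2) ∈ F.touched (τ.out a b) ∨ C x.1 x.2.2 ∈ R) := by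
    rintro ⟨i, k, j⟩ hx
    obtain ⟨hna, hlb⟩ := (Finset.mem_filter.1 hx).2
    simp only [Live, not_or, not_exists, not_and] at hna hlb
    obtain ⟨hna, hnr⟩ := hna
    have hpar : ∀ t, a ≤ t → t ≤ b → ∀ v ∈ F.path i k j,
        v ∈ (τ.pos t).red ∨ v ∈ (τ.pos t).blue → A i k ∈ R ∧ B k j ∈ R := by
      intro t h1 h2 v hv hvt
      have h := τ.parents_subset_everRed_of_no_pebble hb (F.enteredAt i k j) hna h1 h2 hv hvt
      rw [F.parents_prod] at h
      exact ⟨h (by simp), h (by simp)⟩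
    rcases hlb with ⟨v, hv, hvb⟩ | hr
    · exact ⟨hpar b hab le_rfl v hv hvb, .inl (Finset.mem_filter.2
        ⟨Finset.mem_univ _, k, v, hv, τ.mem_out_of_pebble hab (hna v hv).2 hvb⟩)⟩
    · obtain ⟨t, h0, h1, h2⟩ := τ.mem_everRed.1 hr
      have hat : a ≤ t := by
        by_contra h
        exact hnr (τ.mem_everRed.2 ⟨t, h0, by omega, h2⟩)
      exact ⟨hpar t hat h1 _ (F.root_mem i k j) (.inl h2),
        .inr (τ.mem_everRed.2 ⟨t, hat, h1, h2⟩)⟩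
  refine (card_sq_le_of_projections _ (entriesIn A R) (entriesIn B R)
    (F.touched (τ.out a b) ∪ entriesIn C R)
    (fun x hx => Finset.mem_filter.2 ⟨Finset.mem_univ _, (hmem x hx).1.1⟩)
    (fun x hx => Finset.mem_filter.2 ⟨Finset.mem_univ _, (hmem x hx).1.2⟩)
    (fun x hx => Finset.mem_union.2 ((hmem x hx).2.imp_right
      fun h => Finset.mem_filter.2 ⟨Finset.mem_univ _, h⟩))).trans ?_
  exact Nat.mul_le_mul_left _
    ((Finset.card_union_le _ _).trans (Nat.add_le_add_right (F.card_touched_le _) _))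

/-- In a complete play every product becomes live in one of the segments. -/
theorem card_le_sum_becomeLive (h0 : τ.pos 0 = G.start)
    (hL : ∀ v, G.IsOutput v → v ∈ (τ.pos L).blue) {cut : ℕ → ℕ} {h : ℕ} (hc0 : cut 0 = 0)
    (hch : cut h = L) :
    m * r * p ≤ ∑ s ∈ Finset.range h, (F.becomeLive τ (cut s) (cut (s + 1))).card := by
  classical
  calc m * r * p = (Finset.univ : Finset (Fin m × Fin r × Fin p)).card := by simp [mul_assoc]
    _ ≤ ((Finset.range h).biUnion fun s => F.becomeLive τ (cut s) (cut (s + 1))).card := by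
      refine Finset.card_le_card fun x _ => ?_
      have hstart : ¬ F.Live τ (cut 0) x := by
        rw [hc0]
        rintro (⟨v, hv, h⟩ | h)
        · have := F.not_isInput hv
          simp [h0, start, this] at h
        · obtain ⟨t, -, ht, h⟩ := τ.mem_everRed.1 h
          obtain rfl : t = 0 := by omega
          simp [h0, start] at h
      -- Pebbles on the path may be gone by the end of the play, but the record that the root was
      -- once in the cache persists.
      have hend : F.Live τ (cut h) x := by
        rw [hch]
        exact .inr (τ.computed_of_complete h0 hL _
          (F.not_isInput (F.root_mem x.1 x.2.1 x.2.2))).1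
      obtain ⟨s, -, h2, h3, h4⟩ := Trace.exists_change (Q := fun s => F.Live τ (cut s) x)
        (Nat.zero_le h) hstart hend
      exact Finset.mem_biUnion.2 ⟨s, Finset.mem_range.2 h2,
        Finset.mem_filter.2 ⟨Finset.mem_univ _, h3, h4⟩⟩
    _ ≤ _ := Finset.card_biUnion_le

end ProductPaths

/-! ### Cutting a play into segments. -/

/-- A play can be cut into segments with at most `M` input and output operations each. -/
theorem Trace.exists_cuts {G : CompGraph} {M L q : ℕ} (τ : G.Trace M L) (hM : 0 < M)
    (hq : ∑ t ∈ Finset.range L, τ.cost t = q) :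
    ∃ cut : ℕ → ℕ, cut 0 = 0 ∧ cut (q / M + 1) = L ∧ ∀ s, cut s ≤ cut (s + 1) ∧ cut (s + 1) ≤ L ∧
      ∑ t ∈ Finset.Ico (cut s) (cut (s + 1)), τ.cost t ≤ M := by
  classical
  set K : ℕ → ℕ := fun t => ∑ u ∈ Finset.range t, τ.cost u with hK
  have hex : ∀ s, ∃ t, t = L ∨ s * M ≤ K t := fun s => ⟨L, .inl rfl⟩
  set cut : ℕ → ℕ := fun s => Nat.find (hex s) with hcut
  have hspec : ∀ s, cut s = L ∨ s * M ≤ K (cut s) := fun s => Nat.find_spec (hex s)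
  have hmin : ∀ s t, (t = L ∨ s * M ≤ K t) → cut s ≤ t := fun s t h => Nat.find_min' (hex s) h
  have hle : ∀ s, cut s ≤ L := fun s => hmin s L (.inl rfl)
  have hmono : ∀ s, cut s ≤ cut (s + 1) := fun s => by
    refine hmin s _ ((hspec (s + 1)).imp_right fun h => le_trans ?_ h)
    exact Nat.mul_le_mul_right _ (Nat.le_succ s)
  -- A move costs at most one, so the first time the cumulative cost reaches `s * M` it does not
  -- overshoot.
  have hup : ∀ s, K (cut s) ≤ s * M := by
    intro s
    by_contra hcon
    obtain ⟨t, ht⟩ : ∃ t, cut s = t + 1 := by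
      refine Nat.exists_eq_succ_of_ne_zero fun h => ?_
      rw [h] at hcon
      simp [hK] at hcon
    have h1 : ¬ (t = L ∨ s * M ≤ K t) := fun h => by have := hmin s t h; omega
    have h2 : K (t + 1) = K t + τ.cost t := Finset.sum_range_succ _ _
    have h3 := (τ.step t (by have := hle s; omega)).cost_le_one
    rw [ht] at hcon
    push Not at h1
    omega
  refine ⟨cut, ?_, ?_, fun s => ⟨hmono s, hle _, ?_⟩⟩
  · exact Nat.le_zero.1 (hmin 0 0 (.inr (by simp)))
  · rcases hspec (q / M + 1) with h | h
    · exact h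
    · have h1 : K (cut (q / M + 1)) ≤ q := by
        rw [← hq]
        exact Finset.sum_le_sum_of_subset (Finset.range_subset_range.2 (hle _))
      have h2 : q < (q / M + 1) * M := by
        rw [mul_comm]; exact Nat.lt_mul_div_succ q hM
      omega
  · have h1 : K (cut s) + ∑ t ∈ Finset.Ico (cut s) (cut (s + 1)), τ.cost t = K (cut (s + 1)) :=
      Finset.sum_range_add_sum_Ico _ (hmono s)
    rcases hspec s with h | h
    · have h2 : cut (s + 1) = cut s := le_antisymm (h ▸ hle _) (hmono s)
      simp [h2]
    · have := hup (s + 1)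
      rw [add_mul] at this
      omega

end CompGraph

/-! ### Disjoint paths from summation trees. -/

namespace Algorithm

variable {ι : Type} {P : Algorithm ι}

theorem IsMulNode.not_isAddNode {u w v u' w' : P.V} (h : P.IsMulNode u w v) :
    ¬ P.IsAddNode u' w' v := by
  intro h'
  -- At the all-ones assignment a product node gives 1 and a sum node gives 2.
  have h1 := h.2 fun _ => 1
  rw [h'.2 fun _ => 1] at h1
  norm_num at h1

theorem IsMulNode.not_isInput {u w v : P.V} (h : P.IsMulNode u w v) : ¬ P.IsInput v := by
  rw [CompGraph.IsInput, h.1]; simp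

theorem IsAddNode.not_isInput {u w v : P.V} (h : P.IsAddNode u w v) : ¬ P.IsInput v := by
  rw [CompGraph.IsInput, h.1]; simp

theorem isInput_inputNode (a : ι) : P.IsInput (P.inputNode a) := (P.inputs.symm a).2

theorem inputNode_injective : Function.Injective P.inputNode :=
  Subtype.val_injective.comp P.inputs.symm.injective

namespace IsSumTree

variable {r r' : ℕ} {leaf : Fin r → P.V} {leaf' : Fin r' → P.V}

theorem not_isInput (hl : ∀ k, ∃ u w, P.IsMulNode u w (leaf k)) {s : Finset (Fin r)} {v : P.V}
    (h : P.IsSumTree leaf s v) : ¬ P.IsInput v := by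
  cases h with
  | leaf k => obtain ⟨u, w, h⟩ := hl k; exact h.not_isInput
  | add _ _ _ hv => exact hv.not_isInput

/-- Two summation trees through the same node share a leaf. -/
theorem exists_leaf_eq (hl : ∀ k, ∃ u w, P.IsMulNode u w (leaf k))
    (hl' : ∀ k, ∃ u w, P.IsMulNode u w (leaf' k)) {s : Finset (Fin r)} {v : P.V}
    (h : P.IsSumTree leaf s v) {s' : Finset (Fin r')} (h' : P.IsSumTree leaf' s' v) :
    ∃ k k', leaf k = leaf' k' := by
  induction h generalizing s' with
  | leaf k =>
    generalize hv : leaf k = v at h'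
    cases h' with
    | leaf k' => exact ⟨k, k', hv⟩
    | add _ _ _ hv' =>
      obtain ⟨u, w, h⟩ := hl k
      exact absurd (hv ▸ hv') h.not_isAddNode
  | @add s t u w v hs ht hst hv ih1 ih2 =>
    cases h' with
    | leaf k' =>
      obtain ⟨u, w, h⟩ := hl' k'
      exact absurd hv h.not_isAddNode
    | @add s' t' u' w' _ hs' ht' hst' hv' =>
      -- Both trees have the same two nodes below their common root, possibly in swapped order.
      have hu : u' ∈ ({u, w} : Finset P.V) := by rw [← hv.1, hv'.1]; simp
      rcases Finset.mem_insert.1 hu with rfl | hu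
      · exact ih1 hs'
      · rw [Finset.mem_singleton] at hu
        subst hu
        exact ih2 hs'

theorem exists_path {s : Finset (Fin r)} {v : P.V} (h : P.IsSumTree leaf s v) :
    ∀ k ∈ s, ∃ S : Set P.V, v ∈ S ∧ CompGraph.EnteredAt P.toCompGraph (leaf k) S ∧
      ∀ u ∈ S, ∃ t, P.IsSumTree leaf t u := by
  induction h with
  | leaf k =>
    intro k' hk'
    obtain rfl := Finset.mem_singleton.1 hk'
    exact ⟨{leaf k'}, rfl, fun v hv => .inl hv, by rintro u rfl; exact ⟨_, .leaf k'⟩⟩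
  | @add s t u w v hs ht hst hv ih1 ih2 =>
    intro k hk
    have extend : ∀ x ∈ P.parents v, (∃ S : Set P.V, x ∈ S ∧
        CompGraph.EnteredAt P.toCompGraph (leaf k) S ∧
          ∀ u ∈ S, ∃ t, P.IsSumTree leaf t u) →
        ∃ S : Set P.V, v ∈ S ∧ CompGraph.EnteredAt P.toCompGraph (leaf k) S ∧
          ∀ u ∈ S, ∃ t, P.IsSumTree leaf t u := by
      rintro x hx ⟨S, hxS, hS, hT⟩
      refine ⟨insert v S, Set.mem_insert _ _, ?_, ?_⟩
      · rintro y (rfl | hy)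
        · exact .inr ⟨x, hx, Set.mem_insert_of_mem _ hxS⟩
        · exact (hS y hy).imp_right fun ⟨z, hz, hzS⟩ => ⟨z, hz, Set.mem_insert_of_mem _ hzS⟩
      · rintro y (rfl | hy)
        · exact ⟨_, .add hs ht hst hv⟩
        · exact hT y hy
    rcases Finset.mem_union.1 hk with hk | hk
    · exact extend u (by rw [hv.1]; simp) (ih1 k hk)
    · exact extend w (by rw [hv.1]; simp) (ih2 k hk)

end IsSumTree

/-- A standard matrix multiplication of matrices with distinct entries has disjoint paths. -/
theorem IsStdMatMul.exists_productPaths {m r p : ℕ} {A : Matrix (Fin m) (Fin r) P.V}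
    {B : Matrix (Fin r) (Fin p) P.V} {C : Matrix (Fin m) (Fin p) P.V} (h : P.IsStdMatMul A B C)
    (hA : ∀ i k i' k', A i k = A i' k' → i = i' ∧ k = k')
    (hB : ∀ k j k' j', B k j = B k' j' → k = k' ∧ j = j')
    (hAB : ∀ i k k' j, A i k ≠ B k' j) : Nonempty (P.toCompGraph.ProductPaths A B C) := by
  obtain ⟨prod, hprod, htree⟩ := h
  -- No entry of `A` is an entry of `B`, so the unordered pair of parents reveals which factor is
  -- which, hence `i` and `j`.
  have hinj : ∀ i k j i' k' j', prod i k j = prod i' k' j' → i = i' ∧ j = j' := by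
    intro i k j i' k' j' he
    have h1 : ({A i k, B k j} : Finset P.V) = {A i' k', B k' j'} := by
      rw [← (hprod i k j).1, he, (hprod i' k' j').1]
    have h2 : A i k ∈ ({A i' k', B k' j'} : Finset P.V) := by rw [← h1]; simp
    have h3 : B k j ∈ ({A i' k', B k' j'} : Finset P.V) := by rw [← h1]; simp
    simp only [Finset.mem_insert, Finset.mem_singleton, hAB, or_false] at h2
    simp only [Finset.mem_insert, Finset.mem_singleton, (hAB _ _ _ _).symm, false_or] at h3
    exact ⟨(hA _ _ _ _ h2).1, (hB _ _ _ _ h3).2⟩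
  have hmul : ∀ i j k, ∃ u w, P.IsMulNode u w (prod i k j) := fun i j k => ⟨_, _, hprod i k j⟩
  have hpath := fun i k j => (htree i j).exists_path k (Finset.mem_univ k)
  choose path hroot hent hsub using hpath
  refine ⟨⟨prod, path, fun i k j => (hprod i k j).1, hent, hroot, ?_, ?_⟩⟩
  · intro i k j i' k' j' v hv hv'
    obtain ⟨s, hs⟩ := hsub _ _ _ v hv
    obtain ⟨s', hs'⟩ := hsub _ _ _ v hv'
    obtain ⟨l, l', he⟩ := hs.exists_leaf_eq (hmul i j) (hmul i' j') hs'
    exact hinj _ _ _ _ _ _ he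
  · intro i k j v hv
    obtain ⟨s, hs⟩ := hsub _ _ _ v hv
    exact hs.not_isInput (hmul i j)

end Algorithm

/-! ### Summing over the segments. -/

namespace CompGraph

namespace ProductPaths

variable {G : CompGraph} {m r p : ℕ} {A : Fin m → Fin r → G.V} {B : Fin r → Fin p → G.V}
  {C : Fin m → Fin p → G.V} (F : G.ProductPaths A B C) {M L : ℕ} (τ : G.Trace M L)

/-- This is where the cache must be small: `M ≤ r ^ 2` turns `N * r ^ 2 ≤ α * β * M ^ 2` into `N ≤ α
* β * M`. -/
theorem card_root_le_mul (F : G.ProductPaths A B C) {a b α β : ℕ} (hM : 0 < M) (hr : M ≤ r ^ 2)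
    (hb : b ≤ L)
    (hD : (τ.dom a b).card ≤ 2 * M) (hA : (entriesIn A (τ.everRed a b)).card ≤ α * M)
    (hB : (entriesIn B (τ.everRed a b)).card ≤ β * M) :
    (entriesIn C (τ.everRed a b)).card ≤ (2 + α * β) * M := by
  obtain ⟨N, hN, hC⟩ := F.card_root_everRed_le τ (a := a) hb
  have h1 : N * M ≤ (α * β * M) * M :=
    calc N * M ≤ N * r ^ 2 := Nat.mul_le_mul_left _ hr
      _ ≤ (α * M) * (β * M) := hN.trans (Nat.mul_le_mul hA hB)
      _ = _ := by ring
  have h2 := Nat.le_of_mul_le_mul_right h1 hM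
  calc _ ≤ 2 * M + α * β * M := hC.trans (Nat.add_le_add hD h2)
    _ = _ := by ring

theorem card_becomeLive_sq_le_mul {a b α β : ℕ} (hM : 0 < M) (hr : M ≤ r ^ 2) (hab : a ≤ b)
    (hb : b ≤ L) (hD : (τ.dom a b).card ≤ 2 * M) (hO : (τ.out a b).card ≤ 2 * M)
    (hA : (entriesIn A (τ.everRed a b)).card ≤ α * M)
    (hB : (entriesIn B (τ.everRed a b)).card ≤ β * M) :
    (F.becomeLive τ a b).card ^ 2 ≤ α * β * (4 + α * β) * M ^ 3 :=
  calc _ ≤ (α * M) * (β * M) * (2 * M + (2 + α * β) * M) :=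
        (F.card_becomeLive_sq_le τ hab hb).trans (Nat.mul_le_mul (Nat.mul_le_mul hA hB)
          (Nat.add_le_add hO (F.card_root_le_mul τ hM hr hb hD hA hB)))
    _ = _ := by ring

/-- The number of products is at most `q / M + 1` times `√(α β (4 + α β) M ^ 3)`, where `α M` and
`β M` bound the numbers of entries of `A` and `B` seen during `M` input and output operations. -/
theorem card_sq_le {q α β : ℕ} (F : G.ProductPaths A B C) (hM : 0 < M) (hr : M ≤ r ^ 2)
    (h0 : τ.pos 0 = G.start)
    (hL : ∀ v, G.IsOutput v → v ∈ (τ.pos L).blue)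
    (hq : ∑ t ∈ Finset.range L, τ.cost t = q)
    (hAB : ∀ a b, b ≤ L → (τ.dom a b).card ≤ 2 * M →
      (entriesIn A (τ.everRed a b)).card ≤ α * M ∧ (entriesIn B (τ.everRed a b)).card ≤ β * M) :
    (m * r * p) ^ 2 ≤ (q / M + 1) ^ 2 * (α * β * (4 + α * β) * M ^ 3) := by
  obtain ⟨cut, hc0, hcL, hcut⟩ := τ.exists_cuts hM hq
  have hT : ∀ s, (F.becomeLive τ (cut s) (cut (s + 1))).card ^ 2 ≤
      α * β * (4 + α * β) * M ^ 3 := by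
    intro s
    obtain ⟨h1, h2, h3⟩ := hcut s
    have hD : (τ.dom (cut s) (cut (s + 1))).card ≤ 2 * M := by
      have := τ.card_dom_le (a := cut s) h2
      have := τ.card_red _ (h1.trans h2)
      omega
    have hO : (τ.out (cut s) (cut (s + 1))).card ≤ 2 * M := by
      have := τ.card_out_le (a := cut s) h2
      have := τ.card_red _ h2
      omega
    exact F.card_becomeLive_sq_le_mul τ hM hr h1 h2 hD hO (hAB _ _ h2 hD).1 (hAB _ _ h2 hD).2
  calc (m * r * p) ^ 2
      ≤ (∑ s ∈ Finset.range (q / M + 1), (F.becomeLive τ (cut s) (cut (s + 1))).card) ^ 2 :=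
        Nat.pow_le_pow_left (F.card_le_sum_becomeLive τ h0 hL hc0 hcL) 2
    _ ≤ (Finset.range (q / M + 1)).card *
        ∑ s ∈ Finset.range (q / M + 1), (F.becomeLive τ (cut s) (cut (s + 1))).card ^ 2 :=
        sq_sum_le_card_mul_sum_sq
    _ ≤ (Finset.range (q / M + 1)).card *
        ∑ s ∈ Finset.range (q / M + 1), α * β * (4 + α * β) * M ^ 3 :=
        Nat.mul_le_mul_left _ (Finset.sum_le_sum fun s _ => hT s)
    _ = _ := by simp; ring

theorem root_injective (F : G.ProductPaths A B C) (k : Fin r) (i : Fin m) (j : Fin p) (i' : Fin m)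
    (j' : Fin p) (h : C i j = C i' j') : i = i' ∧ j = j' :=
  F.disjoint (F.root_mem i k j) (h ▸ F.root_mem i' k j')

end ProductPaths

theorem Trace.card_entriesIn_input_le {G : CompGraph} {M L m r : ℕ} (τ : G.Trace M L)
    {A : Fin m → Fin r → G.V} (hi : ∀ i k, G.IsInput (A i k))
    (hA : ∀ i k i' k', A i k = A i' k' → i = i' ∧ k = k') {a b : ℕ} (hb : b ≤ L) :
    (entriesIn A (τ.everRed a b)).card ≤ (τ.dom a b).card :=
  card_entriesIn_le hA fun i k h => τ.mem_dom_of_isInput hb (hi i k) h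

end CompGraph

/-! ### The triple product and the final bound. -/

open CompGraph in
/-- The number of products in a standard triple product of input matrices is bounded in terms of
the number `q` of input and output operations. -/
theorem Algorithm.IsStdTripleProduct.card_sq_le {ι : Type} {P : Algorithm ι} {n d M L q : ℕ}
    {A : Matrix (Fin n) (Fin d) P.V} {B : Matrix (Fin d) (Fin d) P.V}
    {C : Matrix (Fin d) (Fin n) P.V} {E : Matrix (Fin n) (Fin n) P.V}
    (h : P.IsStdTripleProduct A B C E)
    (hA : ∀ i k i' k', A i k = A i' k' → i = i' ∧ k = k')
    (hB : ∀ i k i' k', B i k = B i' k' → i = i' ∧ k = k')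
    (hC : ∀ i k i' k', C i k = C i' k' → i = i' ∧ k = k')
    (hiA : ∀ i k, P.IsInput (A i k)) (hiB : ∀ i k, P.IsInput (B i k))
    (hiC : ∀ i k, P.IsInput (C i k))
    (hAB : ∀ i k k' j, A i k ≠ B k' j) (hBC : ∀ i k k' j, B i k ≠ C k' j)
    (hn : 0 < n) (hM : 0 < M) (hd : M ≤ d ^ 2)
    (τ : P.toCompGraph.Trace M L) (h0 : τ.pos 0 = P.toCompGraph.start)
    (hL : ∀ v, P.IsOutput v → v ∈ (τ.pos L).blue)
    (hq : ∑ t ∈ Finset.range L, τ.cost t = q) :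
    d ^ 2 ≤ q ∧ (n * d ^ 2) ^ 2 ≤ (q / M + 1) ^ 2 * (32 * M ^ 3) ∧
      (n ^ 2 * d) ^ 2 ≤ (q / M + 1) ^ 2 * (192 * M ^ 3) := by
  have hd0 : 0 < d := Nat.pos_of_ne_zero fun h => by subst h; simp at hd; omega
  have hloaded : (∀ k j, B k j ∈ τ.everRed 0 L) → d ^ 2 ≤ q := by
    intro hall
    have h1 := τ.card_entriesIn_input_le hiB hB (a := 0) le_rfl
    have h2 := τ.card_dom_le (a := 0) le_rfl
    have h3 : (entriesIn (G := P.toCompGraph) B (τ.everRed 0 L)).card = d ^ 2 := by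
      simp [entriesIn, hall, sq]
    simp only [h0, start, Finset.card_empty, zero_add, Nat.Ico_zero_eq_range, hq] at h2
    omega
  rcases h with ⟨S, h1, h2⟩ | ⟨S, h1, h2⟩
  · obtain ⟨F⟩ := h1.exists_productPaths hA hB hAB
    have hS := F.root_injective ⟨0, hd0⟩
    have hiS : ∀ i j, ¬ P.IsInput (S i j) := fun i j => F.not_isInput (F.root_mem i ⟨0, hd0⟩ j)
    obtain ⟨F'⟩ := h2.exists_productPaths hS hC
      fun i k k' j he => hiS i k (he ▸ hiC k' j)
    -- Computing row 0 of `S` needs every entry of `B`; this uses `0 < n`.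
    have hall : ∀ k j, B k j ∈ τ.everRed 0 L := by
      intro k j
      obtain ⟨t, -, ht, h⟩ := τ.mem_everRed.1
        (τ.computed_of_complete h0 hL _ (hiS ⟨0, hn⟩ j)).1
      have := τ.parents_subset_everRed_of_no_pebble le_rfl (F.enteredAt ⟨0, hn⟩ k j)
        (fun v hv => by simp [h0, start, F.not_isInput hv]) (Nat.zero_le t) ht
        (F.root_mem _ _ _) (.inl h)
      rw [F.parents_prod] at this
      exact this (by simp)
    have hseg : ∀ a b, b ≤ L → (τ.dom a b).card ≤ 2 * M →
        (entriesIn (G := P.toCompGraph) A (τ.everRed a b)).card ≤ 2 * M ∧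
          (entriesIn (G := P.toCompGraph) B (τ.everRed a b)).card ≤ 2 * M := fun a b hb hD =>
      ⟨(τ.card_entriesIn_input_le hiA hA hb).trans hD,
        (τ.card_entriesIn_input_le hiB hB hb).trans hD⟩
    have b1 := F.card_sq_le τ hM hd h0 hL hq hseg
    -- `6 = 2 + 2 * 2` bounds the visible entries of the intermediate `S`; then `12 * (4 + 12) =
    -- 192`.
    have b2 := F'.card_sq_le τ (α := 6) (β := 2) hM hd h0 hL hq fun a b hb hD =>
      ⟨F.card_root_le_mul τ hM hd hb hD (hseg a b hb hD).1 (hseg a b hb hD).2,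
        (τ.card_entriesIn_input_le hiC hC hb).trans hD⟩
    exact ⟨hloaded hall, by convert b1 using 1; ring, by convert b2 using 1; ring⟩
  · obtain ⟨F⟩ := h1.exists_productPaths hB hC hBC
    have hS := F.root_injective ⟨0, hd0⟩
    have hiS : ∀ i j, ¬ P.IsInput (S i j) := fun i j => F.not_isInput (F.root_mem i ⟨0, hd0⟩ j)
    obtain ⟨F'⟩ := h2.exists_productPaths hA hS
      fun i k k' j he => hiS k' j (he ▸ hiA i k)
    have hall : ∀ k j, B k j ∈ τ.everRed 0 L := by
      intro k j
      obtain ⟨t, -, ht, h⟩ := τ.mem_everRed.1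
        (τ.computed_of_complete h0 hL _ (hiS k ⟨0, hn⟩)).1
      have := τ.parents_subset_everRed_of_no_pebble le_rfl (F.enteredAt k j ⟨0, hn⟩)
        (fun v hv => by simp [h0, start, F.not_isInput hv]) (Nat.zero_le t) ht
        (F.root_mem _ _ _) (.inl h)
      rw [F.parents_prod] at this
      exact this (by simp)
    have hseg : ∀ a b, b ≤ L → (τ.dom a b).card ≤ 2 * M →
        (entriesIn (G := P.toCompGraph) B (τ.everRed a b)).card ≤ 2 * M ∧
          (entriesIn (G := P.toCompGraph) C (τ.everRed a b)).card ≤ 2 * M := fun a b hb hD =>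
      ⟨(τ.card_entriesIn_input_le hiB hB hb).trans hD,
        (τ.card_entriesIn_input_le hiC hC hb).trans hD⟩
    have b1 := F.card_sq_le τ hM hd h0 hL hq hseg
    have b2 := F'.card_sq_le τ (α := 2) (β := 6) hM hd h0 hL hq fun a b hb hD =>
      ⟨(τ.card_entriesIn_input_le hiA hA hb).trans hD,
        F.card_root_le_mul τ hM hd hb hD (hseg a b hb hD).1 (hseg a b hb hD).2⟩
    exact ⟨hloaded hall, by convert b1 using 1; ring, by convert b2 using 1; ring⟩

/-- Every complete play for an attention gradient algorithm with `M ≤ d ^ 2` has many input and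
output operations. -/
theorem AttentionGradientAlgorithm.le_of_completesWith {n d M q : ℕ}
    (P : AttentionGradientAlgorithm n d) (hM : 0 < M) (hd : M ≤ d ^ 2)
    (h : P.CompletesWith M q) :
    1 / 40 * (((n : ℝ) ^ 2 * d + n * (d : ℝ) ^ 2) / √(M : ℝ)) ≤ q := by
  rcases Nat.eq_zero_or_pos n with rfl | hn
  · simp
  obtain ⟨c, hplay, hc⟩ := h
  obtain ⟨L, τ, h0, rfl, hq⟩ := hplay.exists_trace
  obtain ⟨E, hE⟩ := P.standard
  have hinj := P.toAlgorithm.inputNode_injective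
  obtain ⟨h1, h2, h3⟩ := hE.card_sq_le
    (fun i k i' k' e => by simpa using hinj e) (fun i k i' k' e => by simpa using hinj e)
    (fun i k i' k' e => by simpa [and_comm] using hinj e)
    (fun _ _ => Algorithm.isInput_inputNode _) (fun _ _ => Algorithm.isInput_inputNode _)
    (fun _ _ => Algorithm.isInput_inputNode _)
    (fun i k k' j e => by simpa using hinj e) (fun i k k' j e => by simpa using hinj e)
    hn hM hd τ h0 hc hq
  have hMR : (0 : ℝ) < M := by exact_mod_cast hM
  have hs : 0 < √(M : ℝ) := Real.sqrt_pos.2 hMR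
  have hss : √(M : ℝ) ^ 2 = M := Real.sq_sqrt hMR.le
  set s := √(M : ℝ)
  set k : ℝ := ((q / M + 1 : ℕ) : ℝ) with hk
  have hk0 : 0 ≤ k := Nat.cast_nonneg _
  have hkq : k * M ≤ 2 * q := by
    -- `M ≤ d ^ 2 ≤ q` absorbs the extra segment.
    have h4 : (q / M + 1) * M ≤ 2 * q := by
      have := Nat.div_mul_le_self q M
      have := hd.trans h1
      rw [add_mul]
      omega
    rw [hk]
    exact_mod_cast h4
  have h2' : ((n : ℝ) * (d : ℝ) ^ 2) ^ 2 ≤ k ^ 2 * (32 * (M : ℝ) ^ 3) := by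
    rw [hk]; exact_mod_cast h2
  have h3' : ((n : ℝ) ^ 2 * (d : ℝ)) ^ 2 ≤ k ^ 2 * (192 * (M : ℝ) ^ 3) := by
    rw [hk]; exact_mod_cast h3
  have hx : 0 ≤ k * (M : ℝ) * s := by positivity
  -- `6 ^ 2 ≥ 32` and, below, `14 ^ 2 ≥ 192`; then `2 * (6 + 14) = 40`.
  have h2'' : (n : ℝ) * (d : ℝ) ^ 2 ≤ 6 * (k * M * s) := by
    refine le_of_sq_le_sq (h2'.trans ?_) (by positivity)
    have : (6 * (k * M * s)) ^ 2 = k ^ 2 * (36 * (M : ℝ) ^ 3) := by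
      rw [mul_pow, mul_pow, mul_pow, hss]; ring
    rw [this]
    gcongr
    norm_num
  have h3'' : (n : ℝ) ^ 2 * (d : ℝ) ≤ 14 * (k * M * s) := by
    refine le_of_sq_le_sq (h3'.trans ?_) (by positivity)
    have : (14 * (k * M * s)) ^ 2 = k ^ 2 * (196 * (M : ℝ) ^ 3) := by
      rw [mul_pow, mul_pow, mul_pow, hss]; ring
    rw [this]
    gcongr
    norm_num
  have h4 : k * M * s ≤ 2 * q * s := mul_le_mul_of_nonneg_right hkq hs.le
  have h5 : ((n : ℝ) ^ 2 * d + n * (d : ℝ) ^ 2) / s ≤ 40 * q := by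
    rw [div_le_iff₀ hs]
    linarith
  linarith

theorem theoremE3 :
    ∃ c : ℝ, 0 < c ∧
      ∀ (ι : Type) (lim : Filter ι) (n d M : ι → ℕ), (∀ i, 0 < M i) →
        (fun i => (M i : ℝ)) =o[lim] (fun i => (d i : ℝ) ^ 2) →
        ∀ᶠ i in lim, ∀ P : AttentionGradientAlgorithm (n i) (d i),
          ENNReal.ofReal
              (c * (((n i : ℝ) ^ 2 * (d i : ℝ) + (n i : ℝ) * (d i : ℝ) ^ 2) / √(M i : ℝ))) ≤
            ((P.toCompGraph.ioComplexity (M i) : ℕ∞) : ℝ≥0∞) := by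
  refine ⟨1 / 40, by norm_num, fun ι lim n d M hM ho => ?_⟩
  filter_upwards [ho.def one_pos] with i hi P
  have hd : M i ≤ d i ^ 2 := by
    have h : (M i : ℝ) ≤ (d i : ℝ) ^ 2 := by simpa using hi
    exact_mod_cast h
  set x : ℝ := 1 / 40 * (((n i : ℝ) ^ 2 * (d i : ℝ) + (n i : ℝ) * (d i : ℝ) ^ 2) / √(M i : ℝ))
  -- Rounding up carries the real bound through the infimum in `ℕ∞`, which is `⊤` if no play
  -- completes.
  have hle : ((⌈x⌉₊ : ℕ) : ℕ∞) ≤ P.toCompGraph.ioComplexity (M i) :=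
    le_iInf₂ fun q hq => Nat.cast_le.2 (Nat.ceil_le.2 (P.le_of_completesWith (hM i) hd hq))
  calc ENNReal.ofReal x ≤ ENNReal.ofReal (⌈x⌉₊ : ℝ) := ENNReal.ofReal_le_ofReal (Nat.le_ceil x)
    _ = (((⌈x⌉₊ : ℕ) : ℕ∞) : ℝ≥0∞) := by simp
    _ ≤ _ := by exact_mod_cast hle
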